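/- Consider an $M|M|\infty$ queue: customers arrive according to a Poisson process of rate $\lambda>0$, there are infinitely many servers, so that the service of each customer starts at its arrival, and the service times are independent of each other and of the arrivals and exponentially distributed with mean $\alpha>0$. Let $\rho=\lambda\alpha$. Let $B$ be the length of a busy period, that is, the time from the arrival of a customer who finds the system empty until the system is next empty. Then $B$ is (almost surely equal to) a random variable, and for all $t\ge 0$, $$1-e^{-\frac{(1-\rho)t}{\alpha}}\;\le\; P(B\le t)\;\le\; 1-e^{-\rho-\frac{(1-\rho e^{-\rho})t}{\alpha}} .$$ -/

import Mathlib

open MeasureTheory ProbabilityTheory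
open scoped NNReal ENNReal

/-- The arrival epoch of customer `n`: customer `0` arrives at time `0`, and `T i` is the time
between the arrivals of customers `i` and `i + 1`. -/
def arrivalTime {Ω : Type*} (T : ℕ → Ω → ℝ) (n : ℕ) (ω : Ω) : ℝ :=
  ∑ i ∈ Finset.range n, T i ω

/-- The number of customers present at time `t` in the infinite server queue with interarrival
times `T` and service times `S`. The service of customer `n` starts at its arrival, so that it is
present during `[arrivalTime T n, arrivalTime T n + S n)`. -/
noncomputable def numberInSystem {Ω : Type*} (T S : ℕ → Ω → ℝ) (t : ℝ) (ω : Ω) : ℕ∞ :=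
  Set.encard {n : ℕ | arrivalTime T n ω ≤ t ∧ t < arrivalTime T n ω + S n ω}

/-- The length of the busy period that customer `0` opens at time `0`: the first time at which
the system is empty, with value `∞` if this never happens. -/
noncomputable def busyPeriod {Ω : Type*} (T S : ℕ → Ω → ℝ) (ω : Ω) : ℝ≥0∞ :=
  ⨅ (t : ℝ≥0) (_ : numberInSystem T S t ω = 0), (t : ℝ≥0∞)

/-- The data of an M|M|∞ queue with arrival rate `lam` and mean service time `α`, observed from
the arrival of a customer that finds the system empty: the interarrival times are exponential with
rate `lam` (Poisson arrivals), the service times are exponential with mean `α`, that is with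
distribution function `1 - exp (-t / α)`, and all these variables are independent. -/
structure IsMMInftyQueue {Ω : Type*} [MeasurableSpace Ω] (μ : Measure Ω) (lam α : ℝ)
    (T S : ℕ → Ω → ℝ) : Prop where
  interarrival_law : ∀ n, HasLaw (T n) (expMeasure lam) μ
  service_law : ∀ n, HasLaw (S n) (expMeasure (1 / α)) μ
  indep : iIndepFun (Sum.elim T S) μ

/-! ### Pathwise description of the busy period. -/

section Deterministic

variable {Ω : Type*} {T S : ℕ → Ω → ℝ} {ω : Ω}

/-! Write `H s = P(B > s)`, and let `N` be the number of customers of the first busy period present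
at time `t`. For nonnegative interarrival and service times, `B > t` exactly when `N ≥ 1`
(`lt_busyPeriod_iff`), so both bounds come from comparing `H t` with `E N`.

Customers of the busy period, apart from customer `0`, arrive at rate `lam` as long as `B > s`, and
one that arrives at `s` is still there at `t` with probability `exp (-(t - s) / α)`. Hence `E N =
exp (-t / α) * (1 + lam * ∫ s in 0..t, exp (s / α) * H s)`; `tsum_lintegral_busyUntilArrival` is the
general form of this.

Upper bound on the tail: `H t ≤ E N`. For `h s = exp (s / α) * H s` this reads `h t ≤ 1 + lam * ∫
h`, and Gronwall gives `h t ≤ exp (lam * t)`.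

Lower bound on the tail: `N ≥ 1` is at least as likely as the existence of a last customer present
at `t`. Given that customer `n` is present, the later arrivals still present at `t` are Poisson in
number with mean at most `ρ`, so `n` is the last with conditional probability at least `p = exp
(-ρ)`. These events are disjoint in `n`, hence `H t ≥ p * E N`, and the reversed Gronwall inequality
gives `h t ≥ p * exp (lam * p * t)`. -/

/-- The last departure epoch among the customers `0, …, n`. -/
noncomputable def lastDeparture {Ω : Type*} (T S : ℕ → Ω → ℝ) : ℕ → Ω → ℝ
  | 0, ω => S 0 ω
  | n + 1, ω => max (lastDeparture T S n ω) (arrivalTime T (n + 1) ω + S (n + 1) ω)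

/-- The event that the system does not become empty before the arrival of customer `n`. -/
def busyUntilArrival {Ω : Type*} (T S : ℕ → Ω → ℝ) (n : ℕ) : Set Ω :=
  {ω | ∀ k < n, arrivalTime T (k + 1) ω ≤ lastDeparture T S k ω}

lemma arrivalTime_zero : arrivalTime T 0 ω = 0 := by simp [arrivalTime]

lemma arrivalTime_succ (n : ℕ) : arrivalTime T (n + 1) ω = arrivalTime T n ω + T n ω := by
  simp [arrivalTime, Finset.sum_range_succ]

lemma arrivalTime_mono (hT : ∀ n, 0 ≤ T n ω) : Monotone fun n => arrivalTime T n ω :=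
  monotone_nat_of_le_succ fun n => by rw [arrivalTime_succ]; linarith [hT n]

lemma arrivalTime_nonneg (hT : ∀ n, 0 ≤ T n ω) (n : ℕ) : 0 ≤ arrivalTime T n ω :=
  Finset.sum_nonneg fun i _ => hT i

lemma lt_lastDeparture_iff {x : ℝ} {n : ℕ} :
    x < lastDeparture T S n ω ↔ ∃ i ≤ n, x < arrivalTime T i ω + S i ω := by
  induction n with
  | zero => simp [lastDeparture, arrivalTime_zero]
  | succ n ih =>
    simp only [lastDeparture, lt_max_iff, ih, Nat.le_succ_iff]
    constructor
    · rintro (⟨i, hi, h⟩ | h)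
      exacts [⟨i, Or.inl hi, h⟩, ⟨n + 1, Or.inr rfl, h⟩]
    · rintro ⟨i, hi | rfl, h⟩
      exacts [Or.inl ⟨i, hi, h⟩, Or.inr h]

lemma le_lastDeparture_iff {x : ℝ} {n : ℕ} :
    x ≤ lastDeparture T S n ω ↔ ∃ i ≤ n, x ≤ arrivalTime T i ω + S i ω := by
  induction n with
  | zero => simp [lastDeparture, arrivalTime_zero]
  | succ n ih =>
    simp only [lastDeparture, le_max_iff, ih, Nat.le_succ_iff]
    constructor
    · rintro (⟨i, hi, h⟩ | h)
      exacts [⟨i, Or.inl hi, h⟩, ⟨n + 1, Or.inr rfl, h⟩]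
    · rintro ⟨i, hi | rfl, h⟩
      exacts [Or.inl ⟨i, hi, h⟩, Or.inr h]

lemma mem_busyUntilArrival_succ {n : ℕ} : ω ∈ busyUntilArrival T S (n + 1) ↔
    ω ∈ busyUntilArrival T S n ∧ arrivalTime T n ω + T n ω ≤ lastDeparture T S n ω := by
  rw [← arrivalTime_succ]
  simp only [busyUntilArrival, Set.mem_ofPred_eq, Nat.forall_lt_succ_right]

lemma busyUntilArrival_anti {m n : ℕ} (h : m ≤ n) (hω : ω ∈ busyUntilArrival T S n) :
    ω ∈ busyUntilArrival T S m := fun k hk => hω k (hk.trans_le h)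

lemma numberInSystem_eq_zero_iff {t : ℝ} : numberInSystem T S t ω = 0 ↔
    ∀ n, arrivalTime T n ω ≤ t → arrivalTime T n ω + S n ω ≤ t := by
  simp [numberInSystem, Set.eq_empty_iff_forall_notMem]

lemma busyPeriod_le_iff {t : ℝ} (ht : 0 ≤ t) : busyPeriod T S ω ≤ ENNReal.ofReal t ↔
    ∃ s, 0 ≤ s ∧ s ≤ t ∧ numberInSystem T S s ω = 0 := by
  constructor
  · intro h
    set Z : Set ℝ≥0 := {s | numberInSystem T S s ω = 0} with hZ
    have hne : Z.Nonempty := by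
      by_contra hne
      rw [Set.not_nonempty_iff_eq_empty, Set.eq_empty_iff_forall_notMem] at hne
      have : busyPeriod T S ω = ⊤ := by
        simp only [busyPeriod, iInf_eq_top]
        exact fun s hs => absurd hs (hne s)
      simp [this] at h
    -- The infimum is attained: a customer who has arrived by `sInf Z` has arrived by every `s ∈ Z`,
    -- hence has left by every such `s`. Half-open presence intervals matter here.
    have hmem : sInf Z ∈ Z := by
      rw [hZ, Set.mem_ofPred_eq, numberInSystem_eq_zero_iff]
      intro n hn
      have key : ∀ s ∈ Z, (arrivalTime T n ω + S n ω).toNNReal ≤ s := by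
        intro s hs
        rw [Real.toNNReal_le_iff_le_coe]
        exact numberInSystem_eq_zero_iff.1 hs n
          (hn.trans (NNReal.coe_le_coe.2 (csInf_le (OrderBot.bddBelow Z) hs)))
      exact Real.toNNReal_le_iff_le_coe.1 (le_csInf hne key)
    refine ⟨((sInf Z : ℝ≥0) : ℝ), NNReal.coe_nonneg _, ?_, hmem⟩
    have h2 : ((sInf Z : ℝ≥0) : ℝ≥0∞) ≤ busyPeriod T S ω :=
      le_iInf₂ fun s hs => ENNReal.coe_le_coe.2 (csInf_le (OrderBot.bddBelow _) hs)
    have h3 := h2.trans h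
    rw [ENNReal.ofReal, ENNReal.coe_le_coe, ← NNReal.coe_le_coe, Real.coe_toNNReal _ ht] at h3
    exact h3
  · rintro ⟨s, hs0, hst, hs⟩
    refine (iInf₂_le s.toNNReal (by rwa [Real.coe_toNNReal _ hs0])).trans ?_
    exact ENNReal.ofReal_le_ofReal hst

lemma lt_busyPeriod_iff_forall {t : ℝ} (ht : 0 ≤ t) : ENNReal.ofReal t < busyPeriod T S ω ↔
    ∀ s, 0 ≤ s → s ≤ t → ∃ n, arrivalTime T n ω ≤ s ∧ s < arrivalTime T n ω + S n ω := by
  rw [← not_le, busyPeriod_le_iff ht]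
  simp only [numberInSystem_eq_zero_iff]
  push Not
  rfl

lemma mem_busyUntilArrival_of_lt_busyPeriod (hT : ∀ n, 0 ≤ T n ω) (hS : 0 ≤ S 0 ω) {t : ℝ}
    (ht : 0 ≤ t) (h : ENNReal.ofReal t < busyPeriod T S ω) {n : ℕ}
    (hn : arrivalTime T n ω ≤ t) : ω ∈ busyUntilArrival T S n := by
  intro k hk
  by_contra! hlt
  have hkt : arrivalTime T (k + 1) ω ≤ t := (arrivalTime_mono hT hk).trans hn
  have h0 : 0 ≤ lastDeparture T S k ω :=
    le_lastDeparture_iff.2 ⟨0, k.zero_le, by simpa [arrivalTime_zero] using hS⟩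
  obtain ⟨m, hm1, hm2⟩ := (lt_busyPeriod_iff_forall ht).1 h _ h0 (hlt.le.trans hkt)
  have hmk : m ≤ k := by
    by_contra! hmk
    exact absurd (hm1.trans_lt hlt) (not_lt.2 (arrivalTime_mono hT hmk))
  exact lt_irrefl _ (lt_lastDeparture_iff.2 ⟨m, hmk, hm2⟩)

/-- If customer `n` joins an unbroken busy period and is present at `t`, every earlier instant lies
between two consecutive arrivals, where `busyUntilArrival` supplies a customer still present. The
right side is a countable union of measurable events, which also yields measurability of
`busyPeriod`. -/
lemma lt_busyPeriod_iff (hT : ∀ n, 0 ≤ T n ω) (hS : 0 ≤ S 0 ω) {t : ℝ} (ht : 0 ≤ t) :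
    ENNReal.ofReal t < busyPeriod T S ω ↔ ∃ n, ω ∈ busyUntilArrival T S n ∧
      arrivalTime T n ω ≤ t ∧ t < arrivalTime T n ω + S n ω := by
  constructor
  · intro h
    obtain ⟨n, hn1, hn2⟩ := (lt_busyPeriod_iff_forall ht).1 h t ht le_rfl
    exact ⟨n, mem_busyUntilArrival_of_lt_busyPeriod hT hS ht h hn1, hn1, hn2⟩
  · rintro ⟨n, hE, hn1, hn2⟩
    rw [lt_busyPeriod_iff_forall ht]
    intro s hs0 hst
    rcases le_or_gt (arrivalTime T n ω) s with h | h
    · exact ⟨n, h, hst.trans_lt hn2⟩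
    · obtain ⟨k, hk, hk1, hk2⟩ : ∃ k < n, arrivalTime T k ω ≤ s ∧ s < arrivalTime T (k + 1) ω := by
        clear hE hn1 hn2
        induction n with
        | zero => rw [arrivalTime_zero] at h; linarith
        | succ n ih =>
          rcases le_or_gt (arrivalTime T n ω) s with h' | h'
          · exact ⟨n, n.lt_succ_self, h', h⟩
          · obtain ⟨k, hk, h2⟩ := ih h'
            exact ⟨k, hk.trans n.lt_succ_self, h2⟩
      obtain ⟨i, hi, hi2⟩ := le_lastDeparture_iff.1 (hE k hk)
      exact ⟨i, (arrivalTime_mono hT hi).trans hk1, hk2.trans_le hi2⟩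

/-- Between arrivals `n` and `n + 1` the event `B > t` depends only on the history up to the service
time of customer `n`, so the next interarrival time can be integrated out. -/
lemma lt_busyPeriod_iff_of_mem_Ico (hT : ∀ n, 0 ≤ T n ω) (hS : 0 ≤ S 0 ω) {t : ℝ} (ht : 0 ≤ t)
    {n : ℕ} (h1 : arrivalTime T n ω ≤ t) (h2 : t < arrivalTime T (n + 1) ω) :
    ENNReal.ofReal t < busyPeriod T S ω ↔
      ω ∈ busyUntilArrival T S n ∧ t < lastDeparture T S n ω := by
  constructor
  · intro h
    refine ⟨mem_busyUntilArrival_of_lt_busyPeriod hT hS ht h h1, ?_⟩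
    obtain ⟨m, hm1, hm2⟩ := (lt_busyPeriod_iff_forall ht).1 h t ht le_rfl
    refine lt_lastDeparture_iff.2 ⟨m, ?_, hm2⟩
    by_contra! hmn
    exact absurd (hm1.trans_lt h2) (not_lt.2 (arrivalTime_mono hT hmn))
  · rintro ⟨hE, hD⟩
    obtain ⟨i, hi, hi2⟩ := lt_lastDeparture_iff.1 hD
    exact (lt_busyPeriod_iff hT hS ht).2
      ⟨i, busyUntilArrival_anti hi hE, (arrivalTime_mono hT hi).trans h1, hi2⟩

end Deterministic

/-! ### The exponential law. -/

section ExpMeasure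

lemma expMeasure_Ioi {r x : ℝ} (hr : 0 < r) (hx : 0 ≤ x) :
    expMeasure r (Set.Ioi x) = ENNReal.ofReal (Real.exp (-(r * x))) := by
  have := isProbabilityMeasure_expMeasure hr
  rw [← Set.compl_Iic, prob_compl_eq_one_sub measurableSet_Iic, ← ofReal_cdf,
    cdf_expMeasure_eq hr, if_pos hx, ← ENNReal.ofReal_one, ← ENNReal.ofReal_sub]
  · ring_nf
  · have : Real.exp (-(r * x)) ≤ 1 := Real.exp_le_one_iff.2 (by nlinarith)
    linarith

lemma expMeasure_Iic {r x : ℝ} (hr : 0 < r) (hx : 0 ≤ x) :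
    expMeasure r (Set.Iic x) = ENNReal.ofReal (1 - Real.exp (-(r * x))) := by
  have := isProbabilityMeasure_expMeasure hr
  rw [← ofReal_cdf, cdf_expMeasure_eq hr, if_pos hx]

lemma expMeasure_ae_nonneg {r : ℝ} (hr : 0 < r) : ∀ᵐ x ∂expMeasure r, 0 ≤ x := by
  have := isProbabilityMeasure_expMeasure hr
  have h : expMeasure r (Set.Iic 0) = 0 := by simp [expMeasure_Iic hr le_rfl]
  rw [ae_iff]
  exact measure_mono_null (fun x hx => (not_le.1 hx).le) h

lemma lintegral_expMeasure {r : ℝ} {f : ℝ → ℝ≥0∞} (hf : Measurable f) :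
    ∫⁻ x, f x ∂expMeasure r = ∫⁻ x, exponentialPDF r x * f x := by
  have h : Measurable (gammaPDF 1 r) := by unfold gammaPDF; fun_prop
  rw [expMeasure, gammaMeasure, lintegral_withDensity_eq_lintegral_mul _ h hf]
  rfl

/-- The exponential density is the rate times the survival function: a point placed an exponential
time after `a` falls in `ds` with weight `r ds` times the probability that it has not yet occurred
by `s`. -/
lemma lintegral_expMeasure_translate {r : ℝ} (hr : 0 < r) {f : ℝ → ℝ≥0∞} (hf : Measurable f)
    (a : ℝ) : ∫⁻ x, f (a + x) ∂expMeasure r = ENNReal.ofReal r *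
      ∫⁻ s, if a ≤ s then ENNReal.ofReal (Real.exp (-(r * (s - a)))) * f s else 0 := by
  have h : Measurable fun x => f (a + x) := hf.comp (by fun_prop)
  rw [lintegral_expMeasure h,
    ← lintegral_sub_right_eq_self (fun x => exponentialPDF r x * f (a + x)) a,
    ← lintegral_const_mul' _ _ ENNReal.ofReal_ne_top]
  refine lintegral_congr fun s => ?_
  rw [exponentialPDF_eq, add_sub_cancel]
  by_cases h : a ≤ s
  · rw [if_pos (sub_nonneg.2 h), if_pos h, ENNReal.ofReal_mul hr.le, mul_assoc]
  · rw [if_neg (by simpa using h), if_neg h]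
    simp

end ExpMeasure

/-! ### Histories of the queue, independence and measurability. -/

section History

/-- The data of an M|M|∞ queue whose variables are everywhere measurable and nonnegative. -/
structure IsRegularMMInftyQueue {Ω : Type*} [MeasurableSpace Ω] (μ : Measure Ω) (lam α : ℝ)
    (T S : ℕ → Ω → ℝ) : Prop extends IsMMInftyQueue μ lam α T S where
  measurable_interarrival : ∀ n, Measurable (T n)
  measurable_service : ∀ n, Measurable (S n)
  interarrival_nonneg : ∀ n ω, 0 ≤ T n ω
  service_nonneg : ∀ n ω, 0 ≤ S n ω

variable {Ω : Type*} {T S : ℕ → Ω → ℝ}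

/-- The σ-algebra generated by the first `n` interarrival times and the first `m` service
times. -/
@[reducible]
def queueHistory {Ω : Type*} (T S : ℕ → Ω → ℝ) (n m : ℕ) : MeasurableSpace Ω :=
  ⨆ i ∈ {i : ℕ ⊕ ℕ | Sum.elim (· < n) (· < m) i},
    MeasurableSpace.comap (Sum.elim T S i) inferInstance

lemma measurable_interarrival_history {n m i : ℕ} (h : i < n) :
    Measurable[queueHistory T S n m] (T i) := by
  refine Measurable.mono (comap_measurable (T i)) ?_ le_rfl
  exact le_iSup₂ (f := fun (i : ℕ ⊕ ℕ) (_ : i ∈ {i : ℕ ⊕ ℕ | Sum.elim (· < n) (· < m) i}) =>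
    MeasurableSpace.comap (Sum.elim T S i) inferInstance) (Sum.inl i) h

lemma measurable_service_history {n m i : ℕ} (h : i < m) :
    Measurable[queueHistory T S n m] (S i) := by
  refine Measurable.mono (comap_measurable (S i)) ?_ le_rfl
  exact le_iSup₂ (f := fun (i : ℕ ⊕ ℕ) (_ : i ∈ {i : ℕ ⊕ ℕ | Sum.elim (· < n) (· < m) i}) =>
    MeasurableSpace.comap (Sum.elim T S i) inferInstance) (Sum.inr i) h

lemma measurable_arrivalTime_history {n m k : ℕ} (h : k ≤ n) :
    Measurable[queueHistory T S n m] (arrivalTime T k) := by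
  unfold arrivalTime
  exact Finset.measurable_fun_sum _ fun i hi =>
    measurable_interarrival_history ((Finset.mem_range.1 hi).trans_le h)

lemma measurable_lastDeparture_history {n m k : ℕ} (hn : k ≤ n) (hm : k < m) :
    Measurable[queueHistory T S n m] (lastDeparture T S k) := by
  induction k with
  | zero =>
    have h : lastDeparture T S 0 = S 0 := by ext ω; simp [lastDeparture]
    rw [h]
    exact measurable_service_history hm
  | succ k ih =>
    let _ := queueHistory T S n m
    have h1 : Measurable (lastDeparture T S k) := ih (by omega) (by omega)
    have h2 : Measurable (arrivalTime T (k + 1)) := measurable_arrivalTime_history (S := S) hn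
    have h3 : Measurable (S (k + 1)) := measurable_service_history (T := T) hm
    have h : lastDeparture T S (k + 1) =
        fun ω => max (lastDeparture T S k ω) (arrivalTime T (k + 1) ω + S (k + 1) ω) := by
      ext ω; simp [lastDeparture]
    rw [h]
    exact h1.max (h2.add h3)

lemma measurableSet_busyUntilArrival_history {n m k : ℕ} (hn : k ≤ n) (hm : k ≤ m) :
    MeasurableSet[queueHistory T S n m] (busyUntilArrival T S k) := by
  have : busyUntilArrival T S k = ⋂ j, ⋂ (_ : j < k),
      {ω | arrivalTime T (j + 1) ω ≤ lastDeparture T S j ω} := by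
    ext ω; simp [busyUntilArrival]
  rw [this]
  refine MeasurableSet.iInter fun j => MeasurableSet.iInter fun hj => ?_
  let _ := queueHistory T S n m
  have h1 : Measurable (arrivalTime T (j + 1)) :=
    measurable_arrivalTime_history (S := S) (by omega)
  have h2 : Measurable (lastDeparture T S j) :=
    measurable_lastDeparture_history (by omega) (by omega)
  exact measurableSet_le h1 h2

namespace IsRegularMMInftyQueue

variable [mΩ : MeasurableSpace Ω] {μ : Measure Ω} {lam α : ℝ}
  (hQ : IsRegularMMInftyQueue μ lam α T S)
include hQ

lemma measurable_elim (i : ℕ ⊕ ℕ) : Measurable (Sum.elim T S i) := by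
  cases i
  exacts [hQ.measurable_interarrival _, hQ.measurable_service _]

lemma history_le (n m : ℕ) : queueHistory T S n m ≤ mΩ :=
  iSup₂_le fun i _ => (hQ.measurable_elim i).comap_le

lemma measurable_arrivalTime (n : ℕ) : Measurable (arrivalTime T n) :=
  (measurable_arrivalTime_history (S := S) (m := 0) le_rfl).mono (hQ.history_le _ _) le_rfl

lemma measurableSet_busyUntilArrival (n : ℕ) : MeasurableSet (busyUntilArrival T S n) :=
  hQ.history_le _ _ _ (measurableSet_busyUntilArrival_history le_rfl le_rfl)

lemma indep_history {n m : ℕ} {j : ℕ ⊕ ℕ} (hj : ¬ Sum.elim (· < n) (· < m) j) :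
    Indep (queueHistory T S n m) (MeasurableSpace.comap (Sum.elim T S j) inferInstance) μ := by
  have h := indep_iSup_of_disjoint (fun i => (hQ.measurable_elim i).comap_le)
    ((iIndepFun_iff_iIndep _ _ _).1 hQ.indep)
    (S := {i : ℕ ⊕ ℕ | Sum.elim (· < n) (· < m) i}) (T := {j})
    (Set.disjoint_singleton_right.2 hj)
  simpa [queueHistory] using h

/-- Fubini for a variable independent of the past. The two indices of the history are separate so
that `S n` may count as past when `T n` is integrated out, and as future when it is itself
integrated out. -/
lemma lintegral_comp_interarrival [IsProbabilityMeasure μ] {n m : ℕ} {𝓧 : Type*}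
    [MeasurableSpace 𝓧] {X : Ω → 𝓧} (hX : Measurable[queueHistory T S n m] X)
    {f : 𝓧 → ℝ → ℝ≥0∞} (hf : Measurable (Function.uncurry f)) :
    ∫⁻ ω, f (X ω) (T n ω) ∂μ = ∫⁻ ω, ∫⁻ v, f (X ω) v ∂expMeasure lam ∂μ := by
  have hX' := hX.mono (hQ.history_le n m) le_rfl
  have hind : IndepFun X (T n) μ := by
    rw [IndepFun_iff_Indep]
    exact indep_of_indep_of_le_left (hQ.indep_history (j := Sum.inl n) (by simp)) hX.comap_le
  have hm := (indepFun_iff_map_prod_eq_prod_map_map hX'.aemeasurable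
    (hQ.measurable_interarrival n).aemeasurable).1 hind
  have : IsProbabilityMeasure (expMeasure lam) := 
    (hQ.interarrival_law n).isProbabilityMeasure_iff.1 ‹_›
  rw [(hQ.interarrival_law n).map_eq] at hm
  calc ∫⁻ ω, f (X ω) (T n ω) ∂μ
      = ∫⁻ z, Function.uncurry f z ∂(μ.map fun ω => (X ω, T n ω)) := by
        rw [lintegral_map hf (hX'.prodMk (hQ.measurable_interarrival n))]; rfl
    _ = ∫⁻ ω, ∫⁻ v, f (X ω) v ∂expMeasure lam ∂μ := by
        rw [hm, lintegral_prod _ hf.aemeasurable, lintegral_map hf.lintegral_prod_right' hX']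
        rfl

lemma lintegral_comp_service [IsProbabilityMeasure μ] {n m : ℕ} {𝓧 : Type*}
    [MeasurableSpace 𝓧] {X : Ω → 𝓧} (hX : Measurable[queueHistory T S n m] X)
    {f : 𝓧 → ℝ → ℝ≥0∞} (hf : Measurable (Function.uncurry f)) :
    ∫⁻ ω, f (X ω) (S m ω) ∂μ = ∫⁻ ω, ∫⁻ v, f (X ω) v ∂expMeasure (1 / α) ∂μ := by
  have hX' := hX.mono (hQ.history_le n m) le_rfl
  have hind : IndepFun X (S m) μ := by
    rw [IndepFun_iff_Indep]
    exact indep_of_indep_of_le_left (hQ.indep_history (j := Sum.inr m) (by simp)) hX.comap_le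
  have hm := (indepFun_iff_map_prod_eq_prod_map_map hX'.aemeasurable
    (hQ.measurable_service m).aemeasurable).1 hind
  have : IsProbabilityMeasure (expMeasure (1 / α)) := 
    (hQ.service_law m).isProbabilityMeasure_iff.1 ‹_›
  rw [(hQ.service_law m).map_eq] at hm
  calc ∫⁻ ω, f (X ω) (S m ω) ∂μ
      = ∫⁻ z, Function.uncurry f z ∂(μ.map fun ω => (X ω, S m ω)) := by
        rw [lintegral_map hf (hX'.prodMk (hQ.measurable_service m))]; rfl
    _ = ∫⁻ ω, ∫⁻ v, f (X ω) v ∂expMeasure (1 / α) ∂μ := by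
        rw [hm, lintegral_prod _ hf.aemeasurable, lintegral_map hf.lintegral_prod_right' hX']
        rfl

lemma measurable_busyPeriod : Measurable (busyPeriod T S) := by
  refine measurable_of_Ioi fun a => ?_
  induction a using ENNReal.recTopCoe with
  | top => simp
  | coe t =>
    have : busyPeriod T S ⁻¹' Set.Ioi (t : ℝ≥0∞) = ⋃ n, busyUntilArrival T S n ∩
        ({ω | arrivalTime T n ω ≤ t} ∩ {ω | (t : ℝ) < arrivalTime T n ω + S n ω}) := by
      ext ω
      simp only [Set.mem_preimage, Set.mem_Ioi, Set.mem_iUnion, Set.mem_inter_iff,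
        Set.mem_ofPred_eq]
      rw [← lt_busyPeriod_iff (fun n => hQ.interarrival_nonneg n ω) (hQ.service_nonneg 0 ω)
        t.coe_nonneg, ENNReal.ofReal_coe_nnreal]
    rw [this]
    have hA := hQ.measurable_arrivalTime
    have hS := hQ.measurable_service
    exact MeasurableSet.iUnion fun n => (hQ.measurableSet_busyUntilArrival n).inter
      ((measurableSet_le (hA n) measurable_const).inter
        (measurableSet_lt measurable_const ((hA n).add (hS n))))

/-- Arrivals do not accumulate: if all epochs are at most `s`, so is each interarrival time, and `n`
independent ones do this with probability `p ^ n`, where `p < 1`. -/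
lemma ae_exists_lt_arrivalTime [IsProbabilityMeasure μ] (hlam : 0 < lam) {s : ℝ} (hs : 0 ≤ s) :
    ∀ᵐ ω ∂μ, ∃ n, s < arrivalTime T n ω := by
  have hind : iIndepFun T μ := hQ.indep.precomp (g := Sum.inl) Sum.inl_injective
  set p : ℝ≥0∞ := ENNReal.ofReal (1 - Real.exp (-(lam * s))) with hp
  have hp1 : p < 1 := by
    rw [hp, ENNReal.ofReal_lt_one]
    linarith [Real.exp_pos (-(lam * s))]
  have hle : ∀ n, μ {ω | ∀ n, arrivalTime T n ω ≤ s} ≤ p ^ n := by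
    intro n
    have h := hind.measure_inter_preimage_eq_mul (Finset.range n) (sets := fun _ => Set.Iic s)
      fun _ _ => measurableSet_Iic
    have h1 : ∀ i, μ (T i ⁻¹' Set.Iic s) = p := fun i => by
      rw [hp, ← expMeasure_Iic hlam hs, ← (hQ.interarrival_law i).map_eq,
        Measure.map_apply (hQ.measurable_interarrival i) measurableSet_Iic]
    simp only [h1, Finset.prod_const, Finset.card_range] at h
    rw [← h]
    refine measure_mono fun ω hω => Set.mem_iInter₂.2 fun i _ => ?_
    have h2 := hω (i + 1)
    rw [arrivalTime_succ] at h2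
    have := arrivalTime_nonneg (fun n => hQ.interarrival_nonneg n ω) i
    change T i ω ≤ s
    linarith
  rw [ae_iff]
  push Not
  exact le_antisymm (ge_of_tendsto' (ENNReal.tendsto_pow_atTop_nhds_zero_of_lt_one hp1) hle)
    zero_le

end IsRegularMMInftyQueue

end History

/-! ### Expected number of customers of the busy period present at a given time. -/

section Compensator

lemma measurableSet_setOf_and {β : Type*} [MeasurableSpace β] {p q : β → Prop}
    (hp : MeasurableSet {x | p x}) (hq : MeasurableSet {x | q x}) :
    MeasurableSet {x | p x ∧ q x} := hp.inter hq

/-- The probability that a service that starts at time `a` is in progress at time `t`. -/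
noncomputable def inServiceProb (α t a : ℝ) : ℝ≥0∞ :=
  if 0 ≤ a ∧ a ≤ t then ENNReal.ofReal (Real.exp (-((t - a) / α))) else 0

lemma measurable_inServiceProb (α t : ℝ) : Measurable (inServiceProb α t) :=
  Measurable.ite (measurableSet_Icc (a := 0) (b := t)) (by fun_prop) measurable_const

namespace IsRegularMMInftyQueue

variable {Ω : Type*} [mΩ : MeasurableSpace Ω] {μ : Measure Ω} {lam α : ℝ} {T S : ℕ → Ω → ℝ}
  (hQ : IsRegularMMInftyQueue μ lam α T S)
include hQ

lemma measure_busy_inter_present [IsProbabilityMeasure μ] (hα : 0 < α) (t : ℝ) (n : ℕ) :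
    μ (busyUntilArrival T S n ∩ {ω | arrivalTime T n ω ≤ t ∧ t < arrivalTime T n ω + S n ω}) =
      ∫⁻ ω, (busyUntilArrival T S n).indicator 1 ω * inServiceProb α t (arrivalTime T n ω) ∂μ := by
  set X : Ω → ℝ≥0∞ × ℝ := fun ω => ((busyUntilArrival T S n).indicator 1 ω, arrivalTime T n ω)
    with hXdef
  have hX : Measurable[queueHistory T S n n] X := by
    let _ := queueHistory T S n n
    have h1 : MeasurableSet (busyUntilArrival T S n) :=
      measurableSet_busyUntilArrival_history le_rfl le_rfl
    have h2 : Measurable (arrivalTime T n) := measurable_arrivalTime_history (S := S) le_rfl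
    exact (measurable_one.indicator h1).prodMk h2
  set f : ℝ≥0∞ × ℝ → ℝ → ℝ≥0∞ := fun x v => x.1 * if x.2 ≤ t ∧ t < x.2 + v then 1 else 0 with hfdef
  have hf : Measurable (Function.uncurry f) := by
    refine Measurable.mul (by fun_prop) (Measurable.ite ?_ measurable_const measurable_const)
    exact measurableSet_setOf_and (measurableSet_le (by fun_prop) (by fun_prop))
      (measurableSet_lt (by fun_prop) (by fun_prop))
  have hA := hQ.measurable_arrivalTime n
  have hS := hQ.measurable_service n
  have hset : MeasurableSet (busyUntilArrival T S n ∩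
      {ω | arrivalTime T n ω ≤ t ∧ t < arrivalTime T n ω + S n ω}) :=
    (hQ.measurableSet_busyUntilArrival n).inter ((measurableSet_le hA measurable_const).inter
        (measurableSet_lt measurable_const (hA.add hS)))
  rw [← lintegral_indicator_one hset]
  calc _ = ∫⁻ ω, f (X ω) (S n ω) ∂μ := by
        refine lintegral_congr fun ω => ?_
        classical
        by_cases h : ω ∈ busyUntilArrival T S n <;>
          simp [hfdef, hXdef, Set.indicator_apply, h]
    _ = ∫⁻ ω, ∫⁻ v, f (X ω) v ∂expMeasure (1 / α) ∂μ := hQ.lintegral_comp_service hX hf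
    _ = _ := by
        refine lintegral_congr fun ω => ?_
        have h0 := arrivalTime_nonneg (fun n => hQ.interarrival_nonneg n ω) n
        simp only [hfdef, hXdef]
        rw [lintegral_const_mul]
        · congr 1
          by_cases h : arrivalTime T n ω ≤ t
          · have h1 : ∀ v, (if arrivalTime T n ω ≤ t ∧ t < arrivalTime T n ω + v then 1 else 0) =
                (Set.Ioi (t - arrivalTime T n ω)).indicator (1 : ℝ → ℝ≥0∞) v := fun v => by
              simp [Set.indicator_apply, h, sub_lt_iff_lt_add']
            simp only [h1]
            rw [lintegral_indicator_one measurableSet_Ioi,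
              expMeasure_Ioi (by positivity) (sub_nonneg.2 h), inServiceProb, if_pos ⟨h0, h⟩]
            congr 3
            ring
          · simp [h, inServiceProb]
        · exact Measurable.ite (measurableSet_setOf_and (MeasurableSet.const _)
            (measurableSet_lt (by fun_prop) (by fun_prop))) measurable_const measurable_const

lemma measurableSet_lt_busyPeriod :
    MeasurableSet {p : ℝ × Ω | ENNReal.ofReal p.1 < busyPeriod T S p.2} :=
  measurableSet_lt (by fun_prop) (hQ.measurable_busyPeriod.comp measurable_snd)

/-- The density of arrival `n + 1` at `s` is `lam` times the probability of no arrival between epoch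
`n` and `s`. Reading this survival factor back as the event `s < arrivalTime T (n + 1)` turns the
busy condition at `s` into `B > s`. Vanishing of `φ` on the negatives is needed because
`ENNReal.ofReal` truncates there. -/
lemma lintegral_busyUntilArrival_succ [IsProbabilityMeasure μ] (hlam : 0 < lam) {φ : ℝ → ℝ≥0∞}
    (hφ : Measurable φ) (hφ0 : ∀ s < 0, φ s = 0) (n : ℕ) :
    ∫⁻ ω, (busyUntilArrival T S (n + 1)).indicator 1 ω * φ (arrivalTime T (n + 1) ω) ∂μ =
      ENNReal.ofReal lam * ∫⁻ s, φ s * μ ({ω | ENNReal.ofReal s < busyPeriod T S ω} ∩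
        {ω | arrivalTime T n ω ≤ s ∧ s < arrivalTime T (n + 1) ω}) := by
  set E := busyUntilArrival T S n
  set X : Ω → ℝ≥0∞ × ℝ × ℝ := fun ω =>
    (E.indicator 1 ω, arrivalTime T n ω, lastDeparture T S n ω) with hXdef
  have hX : Measurable[queueHistory T S n (n + 1)] X := by
    let _ := queueHistory T S n (n + 1)
    have h1 : MeasurableSet E := measurableSet_busyUntilArrival_history le_rfl n.le_succ
    have h2 : Measurable (arrivalTime T n) := measurable_arrivalTime_history (S := S) le_rfl
    have h3 : Measurable (lastDeparture T S n) :=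
      measurable_lastDeparture_history le_rfl n.lt_succ_self
    exact (measurable_one.indicator h1).prodMk (h2.prodMk h3)
  have hX' : Measurable X := hX.mono (hQ.history_le _ _) le_rfl
  set f : ℝ≥0∞ × ℝ × ℝ → ℝ → ℝ≥0∞ := fun x v =>
    x.1 * if x.2.1 + v ≤ x.2.2 then φ (x.2.1 + v) else 0 with hfdef
  have hf : Measurable (Function.uncurry f) :=
    Measurable.mul (by fun_prop) (Measurable.ite
      (measurableSet_le (by fun_prop) (by fun_prop)) (hφ.comp (by fun_prop)) measurable_const)
  set k : ℝ≥0∞ × ℝ × ℝ → ℝ → ℝ≥0∞ := fun x s =>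
    if x.2.1 ≤ s ∧ s < x.2.2 then ENNReal.ofReal (Real.exp (-(lam * (s - x.2.1)))) else 0 with hkdef
  have hk : Measurable (Function.uncurry k) := by
    refine Measurable.ite ?_ (by fun_prop) measurable_const
    exact measurableSet_setOf_and (measurableSet_le (by fun_prop) (by fun_prop))
      (measurableSet_lt (by fun_prop) (by fun_prop))
  have hkm : ∀ x, Measurable (k x) := fun x => hk.comp (measurable_const.prodMk measurable_id)
  have hinner : ∀ x : ℝ≥0∞ × ℝ × ℝ, ∫⁻ v, f x v ∂expMeasure lam =
      ENNReal.ofReal lam * ∫⁻ s, φ s * (x.1 * k x s) := by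
    rintro ⟨w, a, d⟩
    have hψ : Measurable fun s => if s ≤ d then φ s else 0 :=
      Measurable.ite measurableSet_Iic hφ measurable_const
    simp only [hfdef]
    have hψ' : Measurable fun v => if a + v ≤ d then φ (a + v) else 0 :=
      hψ.comp (by fun_prop : Measurable fun v => a + v)
    have htr := lintegral_expMeasure_translate hlam hψ a
    beta_reduce at htr
    rw [lintegral_const_mul _ hψ', htr, mul_left_comm]
    have h1 : ∀ s, φ s * (w * k (w, a, d) s) = w * (φ s * k (w, a, d) s) := fun s => by ring
    simp only [h1]
    rw [lintegral_const_mul w (f := fun s => φ s * k (w, a, d) s) (hφ.mul (hkm _))]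
    congr 2
    refine lintegral_congr_ae ?_
    -- An arrival exactly at the last departure keeps the system busy (`s ≤ d`), whereas `B > s`
    -- needs `s < d`; the discrepancy is a null set.
    filter_upwards [Measure.ae_ne volume d] with s hs
    simp only [hkdef]
    rcases lt_or_gt_of_ne hs with h | h
    · by_cases ha : a ≤ s <;> simp [h, h.le, ha, mul_comm]
    · simp [not_le.2 h, not_lt.2 h.le]
  have hprob : ∀ s, 0 ≤ s → ∫⁻ ω, (X ω).1 * k (X ω) s ∂μ =
      μ ({ω | ENNReal.ofReal s < busyPeriod T S ω} ∩
        {ω | arrivalTime T n ω ≤ s ∧ s < arrivalTime T (n + 1) ω}) := by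
    intro s hs
    set g : ℝ≥0∞ × ℝ × ℝ → ℝ → ℝ≥0∞ := fun x v =>
      x.1 * if (x.2.1 ≤ s ∧ s < x.2.2) ∧ s < x.2.1 + v then 1 else 0 with hgdef
    have hg : Measurable (Function.uncurry g) := by
      refine Measurable.mul (by fun_prop) (Measurable.ite ?_ measurable_const measurable_const)
      exact measurableSet_setOf_and (measurableSet_setOf_and
        (measurableSet_le (by fun_prop) (by fun_prop))
        (measurableSet_lt (by fun_prop) (by fun_prop)))
        (measurableSet_lt (by fun_prop) (by fun_prop))
    have hset : MeasurableSet ({ω | ENNReal.ofReal s < busyPeriod T S ω} ∩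
        {ω | arrivalTime T n ω ≤ s ∧ s < arrivalTime T (n + 1) ω}) :=
      (measurableSet_lt measurable_const hQ.measurable_busyPeriod).inter
        ((measurableSet_le (hQ.measurable_arrivalTime _) measurable_const).inter
        (measurableSet_lt measurable_const (hQ.measurable_arrivalTime _)))
    rw [← lintegral_indicator_one hset]
    symm
    calc _ = ∫⁻ ω, g (X ω) (T n ω) ∂μ := by
          refine lintegral_congr fun ω => ?_
          have key := lt_busyPeriod_iff_of_mem_Ico (n := n)
            (fun n => hQ.interarrival_nonneg n ω) (hQ.service_nonneg 0 ω) hs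
          classical
          simp only [Set.indicator_apply, Set.mem_inter_iff, Set.mem_ofPred_eq, hgdef, hXdef,
            ← arrivalTime_succ, Pi.one_apply]
          by_cases h1 : arrivalTime T n ω ≤ s
          · by_cases h2 : s < arrivalTime T (n + 1) ω
            · simp only [key h1 h2]
              by_cases h3 : ω ∈ E
              · simp only [show ω ∈ busyUntilArrival T S n from h3, h1, h2, h3]
                simp
              · simp only [show ω ∉ busyUntilArrival T S n from h3, h1, h2, h3]
                simp
            · simp [h2]
          · simp [h1]
      _ = ∫⁻ ω, ∫⁻ v, g (X ω) v ∂expMeasure lam ∂μ := hQ.lintegral_comp_interarrival hX hg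
      _ = _ := by
          refine lintegral_congr fun ω => ?_
          generalize X ω = x
          obtain ⟨w, a, d⟩ := x
          simp only [hgdef, hkdef]
          rw [lintegral_const_mul]
          · congr 1
            by_cases h : a ≤ s ∧ s < d
            · have h1 : ∀ v, (if (a ≤ s ∧ s < d) ∧ s < a + v then 1 else 0) =
                  (Set.Ioi (s - a)).indicator (1 : ℝ → ℝ≥0∞) v := fun v => by
                simp [Set.indicator_apply, h, sub_lt_iff_lt_add']
              simp only [h1]
              rw [lintegral_indicator_one measurableSet_Ioi,
                expMeasure_Ioi hlam (sub_nonneg.2 h.1), if_pos h]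
            · simp [h]
          · exact Measurable.ite (measurableSet_setOf_and (MeasurableSet.const _)
              (measurableSet_lt (by fun_prop) (by fun_prop))) measurable_const measurable_const
  calc _ = ∫⁻ ω, f (X ω) (T n ω) ∂μ := by
        refine lintegral_congr fun ω => ?_
        classical
        simp only [hfdef, hXdef, arrivalTime_succ]
        have h4 : ω ∈ busyUntilArrival T S (n + 1) ↔
            ω ∈ E ∧ arrivalTime T n ω + T n ω ≤ lastDeparture T S n ω := mem_busyUntilArrival_succ
        by_cases h : arrivalTime T n ω + T n ω ≤ lastDeparture T S n ω <;>
          by_cases h3 : ω ∈ E <;> simp only [Set.indicator_apply, h4, h, h3] <;> simp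
    _ = ∫⁻ ω, ∫⁻ v, f (X ω) v ∂expMeasure lam ∂μ := hQ.lintegral_comp_interarrival hX hf
    _ = ENNReal.ofReal lam * ∫⁻ ω, (∫⁻ s, φ s * ((X ω).1 * k (X ω) s)) ∂μ := by
        simp only [hinner]
        rw [lintegral_const_mul' _ _ ENNReal.ofReal_ne_top]
    _ = ENNReal.ofReal lam * ∫⁻ s, ∫⁻ ω, φ s * ((X ω).1 * k (X ω) s) ∂μ := by
        rw [lintegral_lintegral_swap]
        refine Measurable.aemeasurable ?_
        exact (hφ.comp measurable_snd).mul ((hX'.fst.comp measurable_fst).mul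
          (hk.comp ((hX'.comp measurable_fst).prodMk measurable_snd)))
    _ = _ := by
        congr 1
        refine lintegral_congr fun s => ?_
        have hm : Measurable fun ω => (X ω).1 * k (X ω) s :=
          hX'.fst.mul (hk.comp (hX'.prodMk measurable_const))
        rw [lintegral_const_mul _ hm]
        rcases lt_or_ge s 0 with hs | hs
        · simp [hφ0 s hs]
        · rw [hprob s hs]

/-- Customer `0` contributes `φ 0`; for the others, almost surely the intervals between consecutive
arrivals partition the half-line, so the events in the preceding lemma add up to `B > s`. -/
lemma tsum_lintegral_busyUntilArrival [IsProbabilityMeasure μ] (hlam : 0 < lam) {φ : ℝ → ℝ≥0∞}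
    (hφ : Measurable φ) (hφ0 : ∀ s < 0, φ s = 0) :
    ∑' n, ∫⁻ ω, (busyUntilArrival T S n).indicator 1 ω * φ (arrivalTime T n ω) ∂μ =
      φ 0 + ENNReal.ofReal lam * ∫⁻ s, φ s * μ {ω | ENNReal.ofReal s < busyPeriod T S ω} := by
  have hC : ∀ n, MeasurableSet
      {p : ℝ × Ω | arrivalTime T n p.2 ≤ p.1 ∧ p.1 < arrivalTime T (n + 1) p.2} := fun n =>
    (measurableSet_le ((hQ.measurable_arrivalTime _).comp measurable_snd) measurable_fst).inter
      (measurableSet_lt measurable_fst ((hQ.measurable_arrivalTime _).comp measurable_snd))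
  have hB := hQ.measurableSet_lt_busyPeriod
  have hm : ∀ n, Measurable fun s => φ s * μ ({ω | ENNReal.ofReal s < busyPeriod T S ω} ∩
        {ω | arrivalTime T n ω ≤ s ∧ s < arrivalTime T (n + 1) ω}) := fun n =>
    hφ.mul (measurable_measure_prodMk_left (hB.inter (hC n)))
  rw [tsum_eq_zero_add' ENNReal.summable]
  congr 1
  · simp [arrivalTime_zero, busyUntilArrival]
  · simp only [hQ.lintegral_busyUntilArrival_succ hlam hφ hφ0]
    rw [ENNReal.tsum_mul_left, ← lintegral_tsum fun n => (hm n).aemeasurable]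
    congr 1
    refine lintegral_congr fun s => ?_
    rw [ENNReal.tsum_mul_left]
    rcases lt_or_ge s 0 with hs | hs
    · simp [hφ0 s hs]
    congr 1
    rw [← measure_iUnion]
    · refine measure_congr ?_
      filter_upwards [hQ.ae_exists_lt_arrivalTime hlam hs] with ω hω
      refine propext ⟨fun h => ?_, fun h => ?_⟩
      · obtain ⟨n, hn⟩ := Set.mem_iUnion.1 h
        exact hn.1
      · obtain ⟨n, h1, h2⟩ : ∃ n, arrivalTime T n ω ≤ s ∧ s < arrivalTime T (n + 1) ω := by
          classical
          have hpos : Nat.find hω ≠ 0 := fun h0 => by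
            have := Nat.find_spec hω
            rw [h0, arrivalTime_zero] at this
            linarith
          obtain ⟨m, hm⟩ := Nat.exists_eq_succ_of_ne_zero hpos
          refine ⟨m, not_lt.1 (Nat.find_min hω (by omega)), ?_⟩
          have := Nat.find_spec hω
          rwa [hm] at this
        exact Set.mem_iUnion.2 ⟨n, h, h1, h2⟩
    · have key : ∀ i j, i < j → Disjoint
          ({ω | ENNReal.ofReal s < busyPeriod T S ω} ∩
            {ω | arrivalTime T i ω ≤ s ∧ s < arrivalTime T (i + 1) ω})
          ({ω | ENNReal.ofReal s < busyPeriod T S ω} ∩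
            {ω | arrivalTime T j ω ≤ s ∧ s < arrivalTime T (j + 1) ω}) := by
        intro i j hij
        refine Set.disjoint_left.2 fun ω hi hj => ?_
        exact absurd (hi.2.2.trans_le
          (arrivalTime_mono (fun n => hQ.interarrival_nonneg n ω) hij)) (not_lt.2 hj.2.1)
      intro i j hij
      rcases lt_or_gt_of_ne hij with h | h
      exacts [key i j h, (key j i h).symm]
    · exact fun n => measurable_prodMk_left (hB.inter (hC n))

/-- Union bound, `P(N ≥ 1) ≤ E N`. -/
lemma measure_lt_busyPeriod_le [IsProbabilityMeasure μ] (hlam : 0 < lam) (hα : 0 < α) {t : ℝ}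
    (ht : 0 ≤ t) : μ {ω | ENNReal.ofReal t < busyPeriod T S ω} ≤
      inServiceProb α t 0 + ENNReal.ofReal lam *
        ∫⁻ s, inServiceProb α t s * μ {ω | ENNReal.ofReal s < busyPeriod T S ω} := by
  rw [← hQ.tsum_lintegral_busyUntilArrival hlam (measurable_inServiceProb α t)
    fun s hs => if_neg fun h => absurd h.1 (not_le.2 hs)]
  simp only [← hQ.measure_busy_inter_present hα]
  refine (measure_mono fun ω hω => ?_).trans (measure_iUnion_le _)
  obtain ⟨n, h⟩ := (lt_busyPeriod_iff (fun n => hQ.interarrival_nonneg n ω)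
    (hQ.service_nonneg 0 ω) ht).1 hω
  exact Set.mem_iUnion.2 ⟨n, h⟩

end IsRegularMMInftyQueue

end Compensator

/-! ### The last customer present at a given time. -/

section LastPresent

/-- The probability that none of the customers who arrive in `(0, u]` is present at time `u`. -/
noncomputable def noneLeftProb (lam α u : ℝ) : ℝ≥0∞ :=
  if 0 ≤ u then ENNReal.ofReal (Real.exp (-(lam * α * (1 - Real.exp (-(u / α)))))) else 1

/-- The probability that none of the customers who arrive in `[0, u]` is present at time `u`, when
one arrives at time `0`. -/
noncomputable def noneLeftProbOfArrival (lam α u : ℝ) : ℝ≥0∞ :=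
  if 0 ≤ u then ENNReal.ofReal (Real.exp (-(lam * α * (1 - Real.exp (-(u / α))))) *
    (1 - Real.exp (-(u / α)))) else 1

lemma measurable_noneLeftProb (lam α : ℝ) : Measurable (noneLeftProb lam α) :=
  Measurable.ite measurableSet_Ici (by fun_prop) measurable_const

lemma measurable_noneLeftProbOfArrival (lam α : ℝ) : Measurable (noneLeftProbOfArrival lam α) :=
  Measurable.ite measurableSet_Ici (by fun_prop) measurable_const

lemma noneLeftProb_le_one {lam α : ℝ} (hlam : 0 < lam) (hα : 0 < α) (u : ℝ) :
    noneLeftProb lam α u ≤ 1 := by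
  unfold noneLeftProb
  split_ifs with hu
  · rw [ENNReal.ofReal_le_one, Real.exp_le_one_iff, neg_nonpos]
    have : Real.exp (-(u / α)) ≤ 1 := Real.exp_le_one_iff.2 (neg_nonpos.2 (by positivity))
    exact mul_nonneg (by positivity) (by linarith)
  · exact le_rfl

lemma le_noneLeftProb {lam α : ℝ} (hlam : 0 < lam) (hα : 0 < α) (u : ℝ) :
    ENNReal.ofReal (Real.exp (-(lam * α))) ≤ noneLeftProb lam α u := by
  have hpos : 0 < lam * α := by positivity
  unfold noneLeftProb
  split_ifs with hu
  · refine ENNReal.ofReal_le_ofReal (Real.exp_le_exp.2 ?_)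
    nlinarith [mul_pos hpos (Real.exp_pos (-(u / α)))]
  · rw [ENNReal.ofReal_le_one, Real.exp_le_one_iff]
    linarith

lemma integral_noneLeft {lam α : ℝ} (hα : 0 < α) (u : ℝ) :
    ∫ x in (0 : ℝ)..u, lam * Real.exp (-(lam * x)) *
      (Real.exp (-(lam * α * (1 - Real.exp (-((u - x) / α))))) * (1 - Real.exp (-((u - x) / α)))) =
      Real.exp (-(lam * α * (1 - Real.exp (-(u / α))))) - Real.exp (-(lam * u)) := by
  have hder : ∀ x, HasDerivAt
      (fun x => -Real.exp (-(lam * x)) * Real.exp (-(lam * α * (1 - Real.exp (-((u - x) / α))))))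
      (lam * Real.exp (-(lam * x)) * (Real.exp (-(lam * α * (1 - Real.exp (-((u - x) / α))))) *
        (1 - Real.exp (-((u - x) / α))))) x := by
    intro x
    have h1 : HasDerivAt (fun x => Real.exp (-(lam * x))) (Real.exp (-(lam * x)) * -(lam * 1)) x :=
      ((hasDerivAt_id x).const_mul lam).neg.exp
    have h2 : HasDerivAt (fun x => Real.exp (-((u - x) / α)))
        (Real.exp (-((u - x) / α)) * -(-1 / α)) x :=
      (((hasDerivAt_id x).const_sub u).div_const α).neg.exp
    have h3 := ((h2.const_sub 1).const_mul (lam * α)).neg.exp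
    have h4 := h1.neg.mul h3
    -- The identity `lam * α / α = lam` makes the derivative of the second factor produce the
    -- missing term `-exp (-(u - x) / α)`.
    refine h4.congr_deriv ?_
    simp only [Pi.neg_apply]
    field_simp
    ring
  rw [intervalIntegral.integral_eq_sub_of_hasDerivAt (fun x _ => hder x)]
  · simp
    ring
  · exact Continuous.intervalIntegrable (by fun_prop) _ _

/-- Renewal equation obtained by conditioning on the first arrival `x`. If `x > u` nobody has come,
which is why both functions take the value `1` at negative arguments. -/
lemma lintegral_noneLeftProbOfArrival {lam α : ℝ} (hlam : 0 < lam) (hα : 0 < α) (u : ℝ) :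
    ∫⁻ x, noneLeftProbOfArrival lam α (u - x) ∂expMeasure lam = noneLeftProb lam α u := by
  have := isProbabilityMeasure_expMeasure hlam
  rcases lt_or_ge u 0 with hu | hu
  · rw [noneLeftProb, if_neg (not_le.2 hu)]
    have h : ∀ᵐ x ∂expMeasure lam, noneLeftProbOfArrival lam α (u - x) = 1 := by
      filter_upwards [expMeasure_ae_nonneg hlam] with x hx
      exact if_neg (by linarith)
    rw [lintegral_congr_ae h]
    simp
  set F : ℝ → ℝ := fun x => lam * Real.exp (-(lam * x)) *
    (Real.exp (-(lam * α * (1 - Real.exp (-((u - x) / α))))) * (1 - Real.exp (-((u - x) / α))))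
    with hF
  have hFc : Continuous F := by fun_prop
  have hle : ∀ x, x ≤ u → Real.exp (-((u - x) / α)) ≤ 1 := fun x hx =>
    Real.exp_le_one_iff.2 (neg_nonpos.2 (div_nonneg (sub_nonneg.2 hx) hα.le))
  have hF0 : ∀ x, x ≤ u → 0 ≤ F x := fun x hx =>
    mul_nonneg (by positivity) (mul_nonneg (by positivity) (by linarith [hle x hx]))
  have hm : Measurable fun x => noneLeftProbOfArrival lam α (u - x) :=
    (measurable_noneLeftProbOfArrival lam α).comp (by fun_prop)
  have h1 : ∫⁻ x in Set.Iic u, noneLeftProbOfArrival lam α (u - x) ∂expMeasure lam =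
      ENNReal.ofReal (∫ x in (0 : ℝ)..u, F x) := by
    rw [← lintegral_indicator measurableSet_Iic,
      lintegral_expMeasure (hm.indicator measurableSet_Iic), intervalIntegral.integral_of_le hu,
      ← integral_Icc_eq_integral_Ioc, ofReal_integral_eq_lintegral_ofReal
        (hFc.continuousOn.integrableOn_compact isCompact_Icc)
        ((ae_restrict_iff' measurableSet_Icc).2 (.of_forall fun x hx => hF0 x hx.2)),
      ← lintegral_indicator measurableSet_Icc]
    refine lintegral_congr fun x => ?_
    rw [exponentialPDF_eq]
    by_cases hx0 : 0 ≤ x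
    · by_cases hxu : x ≤ u
      · rw [Set.indicator_of_mem (Set.mem_Iic.2 hxu), Set.indicator_of_mem (Set.mem_Icc.2 ⟨hx0, hxu⟩),
          if_pos hx0, noneLeftProbOfArrival, if_pos (sub_nonneg.2 hxu),
          ← ENNReal.ofReal_mul (by positivity)]
      · simp [hxu]
    · simp [hx0]
  have h2 : ∫⁻ x in (Set.Iic u)ᶜ, noneLeftProbOfArrival lam α (u - x) ∂expMeasure lam =
      ENNReal.ofReal (Real.exp (-(lam * u))) := by
    rw [setLIntegral_congr_fun (g := fun _ => 1) measurableSet_Iic.compl, setLIntegral_one,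
      Set.compl_Iic, expMeasure_Ioi hlam hu]
    intro x hx
    have : u < x := by simpa using hx
    exact if_neg (by linarith)
  rw [← lintegral_add_compl _ measurableSet_Iic, h1, h2, ← ENNReal.ofReal_add
    (intervalIntegral.integral_nonneg hu fun x hx => hF0 x hx.2) (by positivity),
    hF, integral_noneLeft hα, sub_add_cancel, noneLeftProb, if_pos hu]

/-- The event that the system does not become empty before the arrival of customer `n`, that
customer `n` is present at time `t`, and that none of the customers `n + 1, …, m` is. -/
def lastPresent {Ω : Type*} (T S : ℕ → Ω → ℝ) (t : ℝ) (n m : ℕ) : Set Ω :=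
  (busyUntilArrival T S n ∩ {ω | arrivalTime T n ω ≤ t ∧ t < arrivalTime T n ω + S n ω}) ∩
    {ω | ∀ j, n < j → j ≤ m → ¬(arrivalTime T j ω ≤ t ∧ t < arrivalTime T j ω + S j ω)}

lemma lastPresent_self {Ω : Type*} (T S : ℕ → Ω → ℝ) (t : ℝ) (n : ℕ) :
    lastPresent T S t n n = busyUntilArrival T S n ∩
      {ω | arrivalTime T n ω ≤ t ∧ t < arrivalTime T n ω + S n ω} :=
  Set.inter_eq_left.2 fun _ _ _ h1 h2 => absurd (h1.trans_le h2) (lt_irrefl _)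

lemma lastPresent_succ {Ω : Type*} (T S : ℕ → Ω → ℝ) (t : ℝ) {n m : ℕ} (h : n ≤ m) :
    lastPresent T S t n (m + 1) = lastPresent T S t n m ∩
      {ω | ¬(arrivalTime T (m + 1) ω ≤ t ∧
        t < arrivalTime T (m + 1) ω + S (m + 1) ω)} := by
  ext ω
  simp only [lastPresent, Set.mem_inter_iff, Set.mem_ofPred_eq, and_assoc]
  refine and_congr_right fun _ => and_congr_right fun _ => and_congr_right fun _ =>
    ⟨fun hj => ⟨fun j h1 h2 => hj j h1 (by omega), hj _ (by omega) le_rfl⟩, fun hj j h1 h2 => ?_⟩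
  rcases Nat.le_succ_iff.1 h2 with h3 | rfl
  exacts [hj.1 j h1 h3, hj.2]

lemma measurableSet_lastPresent_history {Ω : Type*} (T S : ℕ → Ω → ℝ) (t : ℝ) {n m k l : ℕ}
    (hnm : n ≤ m) (hk : m ≤ k) (hl : m < l) :
    MeasurableSet[queueHistory T S k l] (lastPresent T S t n m) := by
  let _ := queueHistory T S k l
  have hP : ∀ j ≤ m, MeasurableSet
      {ω | arrivalTime T j ω ≤ t ∧ t < arrivalTime T j ω + S j ω} := fun j hj => by
    have h2 : Measurable (arrivalTime T j) :=
      measurable_arrivalTime_history (S := S) (hj.trans hk)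
    have h3 : Measurable (S j) := measurable_service_history (T := T) (hj.trans_lt hl)
    exact measurableSet_setOf_and (measurableSet_le h2 measurable_const)
      (measurableSet_lt measurable_const (h2.add h3))
  induction m, hnm using Nat.le_induction with
  | base =>
    rw [lastPresent_self]
    exact (measurableSet_busyUntilArrival_history hk hl.le).inter (hP n le_rfl)
  | succ m hm ih =>
    rw [lastPresent_succ T S t hm]
    exact (ih (by omega) (by omega) fun j hj => hP j (by omega)).inter (hP (m + 1) le_rfl).compl

namespace IsRegularMMInftyQueue

variable {Ω : Type*} [mΩ : MeasurableSpace Ω] {μ : Measure Ω} {lam α : ℝ} {T S : ℕ → Ω → ℝ}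
  (hQ : IsRegularMMInftyQueue μ lam α T S)
include hQ

lemma measurableSet_lastPresent (t : ℝ) {n m : ℕ} (h : n ≤ m) :
    MeasurableSet (lastPresent T S t n m) :=
  hQ.history_le _ _ _ (measurableSet_lastPresent_history T S t h le_rfl m.lt_succ_self)

/-- Martingale property: the integrand is the conditional probability, given the first `m` customers
after `0`, that `n` is the last one present. Integrating out `S (m + 1)` leaves the probability with
an arrival at epoch `m + 1`, and integrating out `T m` applies the renewal equation. -/
lemma lintegral_lastPresent_succ [IsProbabilityMeasure μ] (hlam : 0 < lam) (hα : 0 < α) (t : ℝ)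
    {n m : ℕ} (hnm : n ≤ m) :
    ∫⁻ ω, (lastPresent T S t n (m + 1)).indicator 1 ω *
        noneLeftProb lam α (t - arrivalTime T (m + 1) ω) ∂μ =
      ∫⁻ ω, (lastPresent T S t n m).indicator 1 ω *
        noneLeftProb lam α (t - arrivalTime T m ω) ∂μ := by
  set V := lastPresent T S t n m with hV
  have hR := measurable_noneLeftProb lam α
  have hK := measurable_noneLeftProbOfArrival lam α
  set X : Ω → ℝ≥0∞ × ℝ := fun ω => (V.indicator 1 ω, arrivalTime T (m + 1) ω) with hXdef
  have hX : Measurable[queueHistory T S (m + 1) (m + 1)] X := by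
    let _ := queueHistory T S (m + 1) (m + 1)
    have h1 : MeasurableSet V :=
      measurableSet_lastPresent_history T S t hnm m.le_succ m.lt_succ_self
    have h2 : Measurable (arrivalTime T (m + 1)) := measurable_arrivalTime_history (S := S) le_rfl
    exact (measurable_one.indicator h1).prodMk h2
  set f : ℝ≥0∞ × ℝ → ℝ → ℝ≥0∞ := fun x y =>
    x.1 * (noneLeftProb lam α (t - x.2) * if x.2 ≤ t ∧ t < x.2 + y then 0 else 1) with hfdef
  have hite : Measurable fun z : (ℝ≥0∞ × ℝ) × ℝ =>
      if z.1.2 ≤ t ∧ t < z.1.2 + z.2 then (0 : ℝ≥0∞) else 1 := by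
    refine Measurable.ite ?_ measurable_const measurable_const
    exact measurableSet_setOf_and (measurableSet_le (by fun_prop) (by fun_prop))
      (measurableSet_lt (by fun_prop) (by fun_prop))
  have hf : Measurable (Function.uncurry f) :=
    Measurable.mul (by fun_prop) (Measurable.mul (hR.comp (by fun_prop)) hite)
  set Y : Ω → ℝ≥0∞ × ℝ := fun ω => (V.indicator 1 ω, arrivalTime T m ω) with hYdef
  have hY : Measurable[queueHistory T S m (m + 1)] Y := by
    let _ := queueHistory T S m (m + 1)
    have h1 : MeasurableSet V :=
      measurableSet_lastPresent_history T S t hnm le_rfl m.lt_succ_self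
    have h2 : Measurable (arrivalTime T m) := measurable_arrivalTime_history (S := S) le_rfl
    exact (measurable_one.indicator h1).prodMk h2
  set g : ℝ≥0∞ × ℝ → ℝ → ℝ≥0∞ := fun x v =>
    x.1 * noneLeftProbOfArrival lam α (t - x.2 - v) with hgdef
  have hg : Measurable (Function.uncurry g) :=
    Measurable.mul (by fun_prop) (hK.comp (by fun_prop))
  have := isProbabilityMeasure_expMeasure (one_div_pos.2 hα)
  calc _ = ∫⁻ ω, f (X ω) (S (m + 1) ω) ∂μ := by
        refine lintegral_congr fun ω => ?_
        rw [lastPresent_succ T S t hnm, Set.inter_indicator_one]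
        classical
        by_cases h : arrivalTime T (m + 1) ω ≤ t ∧ t < arrivalTime T (m + 1) ω + S (m + 1) ω
        · simp [hfdef, hXdef, Set.indicator_apply, h, ← hV]
        · simp only [hfdef, hXdef, Set.indicator_apply, ← hV, Pi.mul_apply, Set.mem_ofPred_eq, h]
          simp
    _ = ∫⁻ ω, ∫⁻ y, f (X ω) y ∂expMeasure (1 / α) ∂μ := hQ.lintegral_comp_service hX hf
    _ = ∫⁻ ω, g (Y ω) (T m ω) ∂μ := by
        refine lintegral_congr fun ω => ?_
        have h1 : g (Y ω) (T m ω) =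
            (X ω).1 * noneLeftProbOfArrival lam α (t - (X ω).2) := by
          simp only [hgdef, hYdef, hXdef, arrivalTime_succ]
          ring_nf
        rw [h1]
        generalize X ω = x
        obtain ⟨w, a⟩ := x
        have hite' : Measurable fun y : ℝ => if a ≤ t ∧ t < a + y then (0 : ℝ≥0∞) else 1 :=
          hite.comp (measurable_const.prodMk measurable_id : Measurable fun y => ((w, a), y))
        simp only [hfdef]
        rw [lintegral_const_mul _ (hite'.const_mul _), lintegral_const_mul _ hite']
        congr 1
        by_cases h : a ≤ t
        · have h2 : ∀ y, (if a ≤ t ∧ t < a + y then 0 else 1) =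
              (Set.Iic (t - a)).indicator (1 : ℝ → ℝ≥0∞) y := fun y => by
            by_cases hy : t < a + y
            · simp [h, hy, sub_lt_iff_lt_add']
            · simp [hy, le_sub_iff_add_le', not_lt.1 hy]
          simp only [h2]
          rw [lintegral_indicator_one measurableSet_Iic,
            expMeasure_Iic (one_div_pos.2 hα) (sub_nonneg.2 h), noneLeftProb,
            noneLeftProbOfArrival, if_pos (sub_nonneg.2 h), if_pos (sub_nonneg.2 h),
            ENNReal.ofReal_mul (by positivity), one_div_mul_eq_div]
        · have h2 : expMeasure α⁻¹ Set.univ = 1 := by rw [← one_div]; exact measure_univ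
          simp [h, h2, noneLeftProb, noneLeftProbOfArrival]
    _ = ∫⁻ ω, ∫⁻ v, g (Y ω) v ∂expMeasure lam ∂μ := hQ.lintegral_comp_interarrival hY hg
    _ = _ := by
        refine lintegral_congr fun ω => ?_
        simp only [hgdef, hYdef]
        rw [lintegral_const_mul, lintegral_noneLeftProbOfArrival hlam hα]
        exact hK.comp (by fun_prop)

/-- The martingale weight is at least `exp (-(lam * α))` at index `n` and at most `1` at index `m`,
so no limit in `m` is required. -/
lemma measure_lastPresent_ge [IsProbabilityMeasure μ] (hlam : 0 < lam) (hα : 0 < α) (t : ℝ)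
    {n m : ℕ} (hnm : n ≤ m) :
    ENNReal.ofReal (Real.exp (-(lam * α))) * μ (lastPresent T S t n n) ≤
      μ (lastPresent T S t n m) := by
  have hconst : ∫⁻ ω, (lastPresent T S t n m).indicator 1 ω *
        noneLeftProb lam α (t - arrivalTime T m ω) ∂μ =
      ∫⁻ ω, (lastPresent T S t n n).indicator 1 ω *
        noneLeftProb lam α (t - arrivalTime T n ω) ∂μ := by
    induction m, hnm using Nat.le_induction with
    | base => rfl
    | succ m hm ih => rw [hQ.lintegral_lastPresent_succ hlam hα t hm, ih]
  rw [← lintegral_indicator_one (hQ.measurableSet_lastPresent t hnm),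
    ← lintegral_indicator_one (hQ.measurableSet_lastPresent t (le_refl n)),
    ← lintegral_const_mul' _ _ ENNReal.ofReal_ne_top]
  calc _ ≤ ∫⁻ ω, (lastPresent T S t n n).indicator 1 ω *
        noneLeftProb lam α (t - arrivalTime T n ω) ∂μ := by
        refine lintegral_mono fun ω => ?_
        rw [mul_comm]
        gcongr
        exact le_noneLeftProb hlam hα _
    _ = _ := hconst.symm
    _ ≤ _ := lintegral_mono fun ω => mul_le_of_le_one_right' (noneLeftProb_le_one hlam hα _)

lemma le_measure_lt_busyPeriod [IsProbabilityMeasure μ] (hlam : 0 < lam) (hα : 0 < α) {t : ℝ}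
    (ht : 0 ≤ t) : ENNReal.ofReal (Real.exp (-(lam * α))) * (inServiceProb α t 0 +
      ENNReal.ofReal lam *
        ∫⁻ s, inServiceProb α t s * μ {ω | ENNReal.ofReal s < busyPeriod T S ω}) ≤
      μ {ω | ENNReal.ofReal t < busyPeriod T S ω} := by
  rw [← hQ.tsum_lintegral_busyUntilArrival hlam (measurable_inServiceProb α t)
    fun s hs => if_neg fun h => absurd h.1 (not_le.2 hs)]
  simp only [← hQ.measure_busy_inter_present hα, ← lastPresent_self]
  rw [← ENNReal.tsum_mul_left]
  -- The intersection over `k` says that `n` is the last customer present; its probability is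
  -- reached by continuity from above.
  have hms : ∀ n, MeasurableSet (⋂ k, lastPresent T S t n (n + k)) := fun n =>
    MeasurableSet.iInter fun k => hQ.measurableSet_lastPresent t (by omega)
  have hdisj : ∀ i j, i < j → Disjoint (⋂ k, lastPresent T S t i (i + k))
      (⋂ k, lastPresent T S t j (j + k)) := by
    intro i j hij
    refine Set.disjoint_left.2 fun ω hi hj => ?_
    have h1 := Set.mem_iInter.1 hi (j - i)
    have h2 := Set.mem_iInter.1 hj 0
    exact h1.2 j hij (by omega) h2.1.2
  calc _ ≤ ∑' n, μ (⋂ k, lastPresent T S t n (n + k)) := by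
        refine ENNReal.tsum_le_tsum fun n => ?_
        rw [Antitone.measure_iInter]
        · exact le_iInf fun k => hQ.measure_lastPresent_ge hlam hα t (by omega)
        · refine antitone_nat_of_succ_le fun k => ?_
          rw [← add_assoc, lastPresent_succ T S t (by omega)]
          exact Set.inter_subset_left
        · exact fun k => (hQ.measurableSet_lastPresent t (by omega)).nullMeasurableSet
        · exact ⟨0, measure_ne_top _ _⟩
    _ = μ (⋃ n, ⋂ k, lastPresent T S t n (n + k)) := by
        rw [measure_iUnion _ hms]
        intro i j hij
        rcases lt_or_gt_of_ne hij with h | h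
        exacts [hdisj i j h, (hdisj j i h).symm]
    _ ≤ _ := by
        refine measure_mono fun ω hω => ?_
        obtain ⟨n, hn⟩ := Set.mem_iUnion.1 hω
        have h := (Set.mem_iInter.1 hn 0).1
        exact (lt_busyPeriod_iff (fun n => hQ.interarrival_nonneg n ω)
          (hQ.service_nonneg 0 ω) ht).2 ⟨n, h.1, h.2⟩

end IsRegularMMInftyQueue

end LastPresent

/-! ### Gronwall inequalities without continuity. -/

section Gronwall

/-- Iterating the hypothesis from the bound `M` gives `M * (c * s) ^ n / n!`, which tends to `0`.
The tail function is only monotone, so a version for integrable functions is used. -/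
lemma nonpos_of_le_mul_integral {g : ℝ → ℝ} {c M t : ℝ} (hc : 0 ≤ c) (ht : 0 ≤ t)
    (hint : IntervalIntegrable g volume 0 t) (hM : ∀ s ∈ Set.Icc 0 t, g s ≤ M)
    (h : ∀ s ∈ Set.Icc 0 t, g s ≤ c * ∫ r in (0 : ℝ)..s, g r) : g t ≤ 0 := by
  have key : ∀ n : ℕ, ∀ s ∈ Set.Icc 0 t, g s ≤ M * ((c * s) ^ n / n.factorial) := by
    intro n
    induction n with
    | zero => simpa using hM
    | succ n ih =>
      intro s hs
      have hsub : Set.uIcc 0 s ⊆ Set.uIcc 0 t := by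
        rw [Set.uIcc_of_le hs.1, Set.uIcc_of_le ht]
        exact Set.Icc_subset_Icc_right hs.2
      have h1 : ∫ r in (0 : ℝ)..s, g r ≤ ∫ r in (0 : ℝ)..s, M * ((c * r) ^ n / n.factorial) :=
        intervalIntegral.integral_mono_on hs.1 (hint.mono_set hsub)
          (Continuous.intervalIntegrable (by fun_prop) _ _)
          fun r hr => ih r ⟨hr.1, hr.2.trans hs.2⟩
      refine (h s hs).trans ((mul_le_mul_of_nonneg_left h1 hc).trans (le_of_eq ?_))
      simp only [mul_pow, mul_div_assoc]
      simp only [intervalIntegral.integral_const_mul, intervalIntegral.integral_div, integral_pow]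
      rw [Nat.factorial_succ]
      push_cast
      field_simp
      simp
      ring
  have hlim := (FloorSemiring.tendsto_pow_div_factorial_atTop (c * t)).const_mul M
  rw [mul_zero] at hlim
  exact ge_of_tendsto' hlim fun n => key n t ⟨ht, le_rfl⟩

lemma integral_const_mul_exp_mul (a c t : ℝ) :
    c * ∫ r in (0 : ℝ)..t, a * Real.exp (c * r) = a * Real.exp (c * t) - a := by
  have hder : ∀ x, HasDerivAt (fun r => a * Real.exp (c * r)) (c * (a * Real.exp (c * x))) x := by
    intro x
    refine (((hasDerivAt_id x).const_mul c).exp.const_mul a).congr_deriv ?_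
    simp only [id]
    ring
  rw [← intervalIntegral.integral_const_mul,
    intervalIntegral.integral_eq_sub_of_hasDerivAt (fun x _ => hder x)]
  · simp
  · exact Continuous.intervalIntegrable (by fun_prop) _ _

lemma le_mul_exp_of_le_integral {h : ℝ → ℝ} {a c M t : ℝ} (hc : 0 ≤ c) (ht : 0 ≤ t)
    (ha : 0 ≤ a) (hint : IntervalIntegrable h volume 0 t) (hM : ∀ s ∈ Set.Icc 0 t, h s ≤ M)
    (hle : ∀ s ∈ Set.Icc 0 t, h s ≤ a + c * ∫ r in (0 : ℝ)..s, h r) :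
    h t ≤ a * Real.exp (c * t) := by
  have he : ∀ s, IntervalIntegrable (fun r => a * Real.exp (c * r)) volume 0 s := fun s =>
    Continuous.intervalIntegrable (by fun_prop) _ _
  refine sub_nonpos.1 (nonpos_of_le_mul_integral (g := fun s => h s - a * Real.exp (c * s))
    (M := M) hc ht (hint.sub (he t)) (fun s hs => ?_) fun s hs => ?_)
  · have : 0 ≤ a * Real.exp (c * s) := by positivity
    linarith [hM s hs]
  · have hsub : Set.uIcc 0 s ⊆ Set.uIcc 0 t := by
      rw [Set.uIcc_of_le hs.1, Set.uIcc_of_le ht]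
      exact Set.Icc_subset_Icc_right hs.2
    rw [intervalIntegral.integral_sub (hint.mono_set hsub) (he s), mul_sub,
      integral_const_mul_exp_mul]
    linarith [hle s hs]

lemma mul_exp_le_of_integral_le {h : ℝ → ℝ} {a c t : ℝ} (hc : 0 ≤ c) (ht : 0 ≤ t)
    (ha : 0 ≤ a) (hint : IntervalIntegrable h volume 0 t) (h0 : ∀ s ∈ Set.Icc 0 t, 0 ≤ h s)
    (hle : ∀ s ∈ Set.Icc 0 t, a + c * ∫ r in (0 : ℝ)..s, h r ≤ h s) :
    a * Real.exp (c * t) ≤ h t := by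
  have he : ∀ s, IntervalIntegrable (fun r => a * Real.exp (c * r)) volume 0 s := fun s =>
    Continuous.intervalIntegrable (by fun_prop) _ _
  refine sub_nonpos.1 (nonpos_of_le_mul_integral (g := fun s => a * Real.exp (c * s) - h s)
    (M := a * Real.exp (c * t)) hc ht ((he t).sub hint) (fun s hs => ?_) fun s hs => ?_)
  · have : a * Real.exp (c * s) ≤ a * Real.exp (c * t) := by
      have := hs.2
      gcongr
    linarith [h0 s hs]
  · have hsub : Set.uIcc 0 s ⊆ Set.uIcc 0 t := by
      rw [Set.uIcc_of_le hs.1, Set.uIcc_of_le ht]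
      exact Set.Icc_subset_Icc_right hs.2
    rw [intervalIntegral.integral_sub (he s) (hint.mono_set hsub), mul_sub,
      integral_const_mul_exp_mul]
    linarith [hle s hs]

end Gronwall

/-! ### From the integral inequalities to the tail bounds. -/

section Bounds

namespace IsRegularMMInftyQueue

variable {Ω : Type*} [mΩ : MeasurableSpace Ω] {μ : Measure Ω} {lam α : ℝ} {T S : ℕ → Ω → ℝ}
  (hQ : IsRegularMMInftyQueue μ lam α T S)

lemma intervalIntegrable_exp_mul_tail [IsProbabilityMeasure μ] (B : Ω → ℝ≥0∞) (α a b : ℝ) :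
    IntervalIntegrable (fun s => Real.exp (s / α) * μ.real {ω | ENNReal.ofReal s < B ω})
      volume a b := by
  have hanti : Antitone fun s => μ.real {ω | ENNReal.ofReal s < B ω} := fun s t hst =>
    measureReal_mono fun ω hω => (ENNReal.ofReal_le_ofReal hst).trans_lt hω
  exact hanti.intervalIntegrable.continuousOn_mul (by fun_prop)

lemma renewal_bound_eq [IsProbabilityMeasure μ] (B : Ω → ℝ≥0∞) (hlam : 0 < lam) {t : ℝ}
    (ht : 0 ≤ t) :
    inServiceProb α t 0 + ENNReal.ofReal lam *
        ∫⁻ s, inServiceProb α t s * μ {ω | ENNReal.ofReal s < B ω} =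
      ENNReal.ofReal (Real.exp (-(t / α)) * (1 + lam * ∫ s in (0 : ℝ)..t,
        Real.exp (s / α) * μ.real {ω | ENNReal.ofReal s < B ω})) := by
  set H : ℝ → ℝ := fun s => μ.real {ω | ENNReal.ofReal s < B ω} with hH
  have hint := (intervalIntegrable_exp_mul_tail (μ := μ) B α 0 t).const_mul (Real.exp (-(t / α)))
  rw [intervalIntegrable_iff_integrableOn_Ioc_of_le ht, ← integrableOn_Icc_iff_integrableOn_Ioc]
    at hint
  have h0 : ∀ s, 0 ≤ Real.exp (-(t / α)) * (Real.exp (s / α) * H s) := fun s => by positivity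
  have h1 : ∫⁻ s, inServiceProb α t s * μ {ω | ENNReal.ofReal s < B ω} =
      ENNReal.ofReal (∫ s in (0 : ℝ)..t, Real.exp (-(t / α)) * (Real.exp (s / α) * H s)) := by
    rw [intervalIntegral.integral_of_le ht, ← integral_Icc_eq_integral_Ioc,
      ofReal_integral_eq_lintegral_ofReal hint (.of_forall h0),
      ← lintegral_indicator measurableSet_Icc]
    refine lintegral_congr fun s => ?_
    by_cases hs : 0 ≤ s ∧ s ≤ t
    · rw [Set.indicator_of_mem (Set.mem_Icc.2 hs), inServiceProb, if_pos hs, ← mul_assoc,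
        ← Real.exp_add, ENNReal.ofReal_mul (by positivity), ofReal_measureReal]
      congr 3
      ring
    · rw [Set.indicator_of_notMem (fun h => hs (Set.mem_Icc.1 h)), inServiceProb, if_neg hs,
        zero_mul]
  have h2 : 0 ≤ ∫ s in (0 : ℝ)..t, Real.exp (-(t / α)) * (Real.exp (s / α) * H s) :=
    intervalIntegral.integral_nonneg ht fun s _ => h0 s
  rw [h1, inServiceProb, if_pos ⟨le_rfl, ht⟩, ← ENNReal.ofReal_mul hlam.le,
    ← ENNReal.ofReal_add (by positivity) (by positivity), intervalIntegral.integral_const_mul]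
  congr 1
  rw [sub_zero]
  ring

include hQ

lemma tail_le [IsProbabilityMeasure μ] (hlam : 0 < lam) (hα : 0 < α) {t : ℝ} (ht : 0 ≤ t) :
    μ.real {ω | ENNReal.ofReal t < busyPeriod T S ω} ≤
      Real.exp (-((1 - lam * α) * t / α)) := by
  set h : ℝ → ℝ := fun s => Real.exp (s / α) *
    μ.real {ω | ENNReal.ofReal s < busyPeriod T S ω} with hh
  have hexp : ∀ s, Real.exp (s / α) * Real.exp (-(s / α)) = 1 := fun s => by
    rw [← Real.exp_add, add_neg_cancel, Real.exp_zero]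
  have h0 : ∀ s, 0 ≤ h s := fun s => by positivity
  have key : h t ≤ 1 * Real.exp (lam * t) := by
    refine le_mul_exp_of_le_integral (M := Real.exp (t / α)) hlam.le ht zero_le_one
      (intervalIntegrable_exp_mul_tail _ α 0 t) (fun s hs => ?_) fun s hs => ?_
    · have h1 : Real.exp (s / α) ≤ Real.exp (t / α) := by
        have := hs.2
        gcongr
      exact (mul_le_of_le_one_right (by positivity) measureReal_le_one).trans h1
    · have h1 := hQ.measure_lt_busyPeriod_le hlam hα hs.1
      rw [renewal_bound_eq _ hlam hs.1] at h1
      have hI : 0 ≤ ∫ r in (0 : ℝ)..s, h r :=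
        intervalIntegral.integral_nonneg hs.1 fun r _ => h0 r
      have h2 := ENNReal.toReal_le_of_le_ofReal (by positivity) h1
      calc h s ≤ Real.exp (s / α) * (Real.exp (-(s / α)) * (1 + lam * ∫ r in (0 : ℝ)..s, h r)) :=
            mul_le_mul_of_nonneg_left h2 (by positivity)
        _ = _ := by rw [← mul_assoc, hexp, one_mul]
  calc μ.real {ω | ENNReal.ofReal t < busyPeriod T S ω}
      = Real.exp (-(t / α)) * h t := by
        rw [hh, ← mul_assoc, mul_comm (Real.exp (-(t / α))), hexp, one_mul]
    _ ≤ Real.exp (-(t / α)) * (1 * Real.exp (lam * t)) :=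
        mul_le_mul_of_nonneg_left key (by positivity)
    _ = _ := by
        rw [one_mul, ← Real.exp_add]
        congr 1
        field_simp
        ring

lemma le_tail [IsProbabilityMeasure μ] (hlam : 0 < lam) (hα : 0 < α) {t : ℝ} (ht : 0 ≤ t) :
    Real.exp (-(lam * α) - (1 - lam * α * Real.exp (-(lam * α))) * t / α) ≤
      μ.real {ω | ENNReal.ofReal t < busyPeriod T S ω} := by
  set p := Real.exp (-(lam * α)) with hp
  set h : ℝ → ℝ := fun s => Real.exp (s / α) *
    μ.real {ω | ENNReal.ofReal s < busyPeriod T S ω} with hh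
  have hexp : ∀ s, Real.exp (s / α) * Real.exp (-(s / α)) = 1 := fun s => by
    rw [← Real.exp_add, add_neg_cancel, Real.exp_zero]
  have h0 : ∀ s, 0 ≤ h s := fun s => by positivity
  -- Both the initial value and the rate `lam` carry the factor `p`, since `p` multiplies all of `E
  -- N`.
  have key : p * Real.exp (lam * p * t) ≤ h t := by
    refine mul_exp_le_of_integral_le (by positivity) ht (by positivity)
      (intervalIntegrable_exp_mul_tail _ α 0 t) (fun s _ => h0 s) fun s hs => ?_
    have h1 := hQ.le_measure_lt_busyPeriod hlam hα hs.1
    rw [renewal_bound_eq _ hlam hs.1, ← ENNReal.ofReal_mul (by positivity)] at h1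
    have h2 := (ENNReal.ofReal_le_iff_le_toReal (measure_ne_top _ _)).1 h1
    calc p + lam * p * ∫ r in (0 : ℝ)..s, h r
        = Real.exp (s / α) * (p * (Real.exp (-(s / α)) * (1 + lam * ∫ r in (0 : ℝ)..s, h r))) := by
          linear_combination (-(p * (1 + lam * ∫ r in (0 : ℝ)..s, h r))) * hexp s
      _ ≤ h s := mul_le_mul_of_nonneg_left h2 (by positivity)
  calc _ = Real.exp (-(t / α)) * (p * Real.exp (lam * p * t)) := by
        have h1 : -(lam * α) - (1 - lam * α * p) * t / α =
            -(lam * α) + (-(t / α) + lam * p * t) := by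
          field_simp
          ring
        rw [h1, Real.exp_add, Real.exp_add, ← hp]
        ring
    _ ≤ Real.exp (-(t / α)) * h t := mul_le_mul_of_nonneg_left key (by positivity)
    _ = _ := by rw [hh, ← mul_assoc, mul_comm (Real.exp (-(t / α))), hexp, one_mul]

end IsRegularMMInftyQueue

/-- The laws only give almost everywhere measurable and nonnegative variables; the positive parts of
measurable representatives change `busyPeriod` only on a null set. -/
lemma IsMMInftyQueue.exists_regular {Ω : Type*} [MeasurableSpace Ω] {μ : Measure Ω}
    {lam α : ℝ} (hlam : 0 < lam) (hα : 0 < α) {T S : ℕ → Ω → ℝ}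
    (hQ : IsMMInftyQueue μ lam α T S) : ∃ T' S' : ℕ → Ω → ℝ,
      IsRegularMMInftyQueue μ lam α T' S' ∧ busyPeriod T' S' =ᵐ[μ] busyPeriod T S := by
  have hreg : ∀ {X : Ω → ℝ} {r : ℝ} (hr : 0 < r), HasLaw X (expMeasure r) μ →
      ∃ Y, Measurable Y ∧ (∀ ω, 0 ≤ Y ω) ∧ Y =ᵐ[μ] X := by
    intro X r hr hX
    have h0 : ∀ᵐ ω ∂μ, 0 ≤ X ω :=
      (hX.ae_iff (p := fun x => 0 ≤ x) (measurableSet_setOfPred.1 measurableSet_Ici)).2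
        (expMeasure_ae_nonneg hr)
    refine ⟨fun ω => max (hX.aemeasurable.mk X ω) 0,
      hX.aemeasurable.measurable_mk.max measurable_const, fun ω => le_max_right _ _, ?_⟩
    filter_upwards [h0, hX.aemeasurable.ae_eq_mk] with ω h1 h2
    rw [← h2, max_eq_left h1]
  choose T' hT1 hT2 hT3 using fun n => hreg hlam (hQ.interarrival_law n)
  choose S' hS1 hS2 hS3 using fun n => hreg (one_div_pos.2 hα) (hQ.service_law n)
  refine ⟨T', S', ⟨⟨fun n => (hQ.interarrival_law n).congr (hT3 n),
    fun n => (hQ.service_law n).congr (hS3 n), hQ.indep.congr fun i => ?_⟩, hT1, hS1, hT2, hS2⟩, ?_⟩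
  · cases i
    exacts [(hT3 _).symm, (hS3 _).symm]
  · filter_upwards [ae_all_iff.2 hT3, ae_all_iff.2 hS3] with ω h1 h2
    simp only [busyPeriod, numberInSystem, arrivalTime, h1, h2]

end Bounds

theorem mainTheorem1 {Ω : Type*} [MeasurableSpace Ω] (μ : Measure Ω) [IsProbabilityMeasure μ]
    (lam α ρ : ℝ) (hlam : 0 < lam) (hα : 0 < α) (hρ : ρ = lam * α)
    (T S : ℕ → Ω → ℝ) (hQ : IsMMInftyQueue μ lam α T S) :
    AEMeasurable (busyPeriod T S) μ ∧
    ∀ t : ℝ, 0 ≤ t →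
      μ.real {ω | busyPeriod T S ω ≤ ENNReal.ofReal t}
          ≤ 1 - Real.exp (-ρ - (1 - ρ * Real.exp (-ρ)) * t / α) ∧
      1 - Real.exp (-((1 - ρ) * t / α))
          ≤ μ.real {ω | busyPeriod T S ω ≤ ENNReal.ofReal t} := by
  obtain ⟨T', S', hQ', hB⟩ := hQ.exists_regular hlam hα
  refine ⟨hQ'.measurable_busyPeriod.aemeasurable.congr hB, fun t ht => ?_⟩
  have h1 : μ.real {ω | busyPeriod T S ω ≤ ENNReal.ofReal t} =
      1 - μ.real {ω | ENNReal.ofReal t < busyPeriod T' S' ω} := by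
    rw [← probReal_compl_eq_one_sub (measurableSet_lt measurable_const hQ'.measurable_busyPeriod)]
    refine measureReal_congr ?_
    filter_upwards [hB] with ω hω
    refine propext ?_
    change busyPeriod T S ω ≤ ENNReal.ofReal t ↔ ¬ (ENNReal.ofReal t < busyPeriod T' S' ω)
    rw [hω, not_lt]
  rw [h1, hρ]
  constructor
  · linarith [hQ'.le_tail hlam hα ht]
  · linarith [hQ'.tail_le hlam hα ht]
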